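/- Let $L\ge 1$ be an integer and let $0<p<1$, $0<q<1$. The walk perturbed at $L$-extrema is the nearest-neighbour random process $(X_k)_{k\ge 0}$ on $\mathbb{Z}$ which, given its past $X_0,\dots,X_k$, moves to $X_k+1$ with probability $p$ if $X_k=\max_{0\le m\le L\wedge k}X_{k-m}$, with probability $q$ if $X_k=\min_{0\le m\le L\wedge k}X_{k-m}$, and with probability $\frac12$ otherwise (also with probability $\frac12$ if $X_k$ is both the maximum and the minimum), and otherwise moves to $X_k-1$. For $k\ge L$ let $Y_k=(\eta_k^1,\dots,\eta_k^L)\in\{-1,+1\}^L$ with $\eta_k^i=X_{k-i+1}-X_{k-i}$. Call $\eta\in\{-1,+1\}^L$ a local maximum if $\eta^1+\dots+\eta^j\ge 0$ for all $1\le j\le L$, and a local minimum if $\eta^1+\dots+\eta^j\le 0$ for all $1\le j\le L$. The chain $Y_k$ has a limiting occupational measure $\pi$ on $\{-1,+1\}^L$, which depends only on $L,p,q$: for every such walk, almost surely, for every $\eta$ the fraction of the times $L\le k<L+n$ with $Y_k=\eta$ converges to $\pi(\eta)$ as $n\to\infty$. Let $\pi(\max)$ and $\pi(\min)$ be the sums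 of $\pi(\eta)$ over the local maxima and over the local minima $\eta$, respectively, and let $$\Delta_L=(2p-1)\,\pi(\max)+(2q-1)\,\pi(\min).$$ Then $\Delta_L<0$, $\Delta_L=0$ or $\Delta_L>0$ if and only if $p+q-1<0$, $p+q-1=0$ or $p+q-1>0$, respectively. -/

import Mathlib

open MeasureTheory Filter Topology

namespace PerturbedWalk

/-- `x k` is the maximum of the values of the path `x` at the times `k - m`, `0 ≤ m ≤ min L k`. -/
def AtMax (L : ℕ) (x : ℕ → ℤ) (k : ℕ) : Prop :=
  ∀ m ≤ min L k, x (k - m) ≤ x k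

/-- `x k` is the minimum of the values of the path `x` at the times `k - m`, `0 ≤ m ≤ min L k`. -/
def AtMin (L : ℕ) (x : ℕ → ℤ) (k : ℕ) : Prop :=
  ∀ m ≤ min L k, x k ≤ x (k - m)

open Classical in
/-- The probability that the walk, having followed the path `x` up to time `k`, makes a step to
the right: `p` at the maximum, `q` at the minimum, `1/2` otherwise (and `1/2` if `x k` is both the
maximum and the minimum). -/
noncomputable def stepUp (L : ℕ) (p q : ℝ) (x : ℕ → ℤ) (k : ℕ) : ℝ :=
  if AtMax L x k ∧ AtMin L x k then 1 / 2
  else if AtMax L x k then p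
  else if AtMin L x k then q
  else 1 / 2

/-- `X` is a perturbed at `L`-extrema random walk with parameters `p` and `q` (started from an
arbitrary integer-valued random variable `X 0`): given any initial piece `x 0, …, x k` of the
trajectory, the next step is `+1` with probability `stepUp L p q x k`, and `-1` otherwise. -/
structure IsPerturbedWalk {Ω : Type*} [MeasurableSpace Ω] (μ : Measure Ω) (L : ℕ) (p q : ℝ)
    (X : ℕ → Ω → ℤ) : Prop where
  measurable : ∀ k, Measurable (X k)
  step_right : ∀ (k : ℕ) (x : ℕ → ℤ),
    μ.real {ω | (∀ j ≤ k, X j ω = x j) ∧ X (k + 1) ω = x k + 1} =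
      stepUp L p q x k * μ.real {ω | ∀ j ≤ k, X j ω = x j}
  step_left : ∀ (k : ℕ) (x : ℕ → ℤ),
    μ.real {ω | (∀ j ≤ k, X j ω = x j) ∧ X (k + 1) ω = x k - 1} =
      (1 - stepUp L p q x k) * μ.real {ω | ∀ j ≤ k, X j ω = x j}

/-- The state space `{-1, +1} ^ L`; the coordinate `i : Fin L` stands for the `(i + 1)`-st most
recent step. -/
abbrev State (L : ℕ) : Type := Fin L → ℤˣ

/-- The last `L` steps before time `k` (for `k ≥ L`), the most recent first, are given by `η`. -/
def HasState {L : ℕ} (x : ℕ → ℤ) (k : ℕ) (η : State L) : Prop :=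
  ∀ i : Fin L, x (k - i) - x (k - i - 1) = (η i : ℤ)

/-- `S(η, j)`, the sum of the first `j` coordinates of `η`. -/
def partialSum {L : ℕ} (η : State L) (j : ℕ) : ℤ :=
  ∑ i : Fin L, if (i : ℕ) < j then (η i : ℤ) else 0

/-- The state `η` is a local maximum. -/
def IsLocMax {L : ℕ} (η : State L) : Prop :=
  ∀ j : ℕ, 1 ≤ j → j ≤ L → 0 ≤ partialSum η j

/-- The state `η` is a local minimum. -/
def IsLocMin {L : ℕ} (η : State L) : Prop :=
  ∀ j : ℕ, 1 ≤ j → j ≤ L → partialSum η j ≤ 0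

open Classical in
/-- The fraction of the times `k = L, …, L + n - 1` at which the path `x` has the state `η`. -/
noncomputable def occupation {L : ℕ} (x : ℕ → ℤ) (η : State L) (n : ℕ) : ℝ :=
  (((Finset.range n).filter fun k => HasState x (L + k) η).card : ℝ) / (n : ℝ)

/-- `π` is the limiting occupational measure of the chain of the last `L` steps of `X`: almost
surely, the fraction of time spent in each state `η` converges to `π η`. -/
def IsLimitingOccupation {Ω : Type*} [MeasurableSpace Ω] (μ : Measure Ω) {L : ℕ}
    (X : ℕ → Ω → ℤ) (π : State L → ℝ) : Prop :=
  ∀ᵐ ω ∂μ, ∀ η : State L, Tendsto (occupation (fun k => X k ω) η) atTop (𝓝 (π η))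

open Classical in
/-- `π(max)`, the total mass of the local maxima. -/
noncomputable def massMax {L : ℕ} (π : State L → ℝ) : ℝ :=
  ∑ η : State L, if IsLocMax η then π η else 0

open Classical in
/-- `π(min)`, the total mass of the local minima. -/
noncomputable def massMin {L : ℕ} (π : State L → ℝ) : ℝ :=
  ∑ η : State L, if IsLocMin η then π η else 0

/-- The speed `Δ = (2p - 1) π(max) + (2q - 1) π(min)`. -/
noncomputable def speed {L : ℕ} (p q : ℝ) (π : State L → ℝ) : ℝ :=
  (2 * p - 1) * massMax π + (2 * q - 1) * massMin π

end PerturbedWalk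

/-!
The walk is compared with the case `q = 1 - p`, in which the probability `u` of a step to the right
satisfies `u (-η) = 1 - u η`. There the drift `2 * u η - 1` is odd, so its stationary mean vanishes
and it is of the form `h - P *ᵥ h`, with `P` the transition matrix for `q = 1 - p`. Integrating `h`
against the stationary law `π` for `p` and `q`, whose transition probabilities differ from those of
`P` at the local minima only, gives `Δ = (p + q - 1) * ∑ π η * (2 + h (η⁺) - h (η⁻))`, where the sum
is over the local minima `η`, and `η⁺` and `η⁻` are the states after a step to the right and to the
left.

The factor `2 + h (η⁺) - h (η⁻)` is the expected final distance of two walks for `q = 1 - p` that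
separate in the state `η`. To see that it is positive, couple the two walks so that they stay
ordered, in a sense that depends on whether `p ≤ 1 / 2`. A smallest value of the expected final
distance persists along `L` common steps to the right; then the two states agree, and it is the
present distance.

The occupation frequencies converge for a similar reason: for `f` on the states, `f - π ⬝ᵥ f` is of
the form `h - P *ᵥ h` for the transition matrix `P`, which turns the time average of `f` into a
martingale average plus a boundary term.
-/

namespace PerturbedWalk

open Matrix Finset

section StochasticMatrix

variable {S : Type*} [Fintype S] {P : Matrix S S ℝ} {π : S → ℝ}

/-- A strictly positive stationary distribution `π` of the Markov chain on `S` with transition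
matrix `P`, as a row vector. -/
structure IsPositiveStationary (P : Matrix S S ℝ) (π : S → ℝ) : Prop where
  pos : ∀ i, 0 < π i
  sum_eq_one : ∑ i, π i = 1
  vecMul_eq : π ᵥ* P = π

lemma IsPositiveStationary.dotProduct_mulVec (hπ : IsPositiveStationary P π) (f : S → ℝ) :
    π ⬝ᵥ (P *ᵥ f) = π ⬝ᵥ f := by
  rw [Matrix.dotProduct_mulVec, hπ.vecMul_eq]

lemma pow_mulVec_eq_self [DecidableEq S] {f : S → ℝ} (hf : P *ᵥ f = f) (k : ℕ) :
    (P ^ k) *ᵥ f = f := by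
  induction k with
  | zero => simp
  | succ k ih => rw [pow_succ, ← mulVec_mulVec, hf, ih]

lemma vecMul_pow_eq_self [DecidableEq S] {v : S → ℝ} (hv : v ᵥ* P = v) (k : ℕ) :
    v ᵥ* (P ^ k) = v := by
  induction k with
  | zero => simp
  | succ k ih => rw [pow_succ, ← vecMul_vecMul, ih, hv]

lemma exists_pow_pos [DecidableEq S] (hirr : P.IsIrreducible) (i j : S) : ∃ k, 0 < (P ^ k) i j := by
  obtain ⟨k, -, hk⟩ := (isIrreducible_iff_exists_pow_pos hirr.nonneg).mp hirr i j
  exact ⟨k, hk⟩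

lemma pos_of_vecMul_eq_self (hirr : P.IsIrreducible) {v : S → ℝ} (hv : v ᵥ* P = v) (hv0 : v ≠ 0)
    (hnn : 0 ≤ v) (j : S) : 0 < v j := by
  classical
  obtain ⟨i, hi⟩ := Function.ne_iff.mp hv0
  obtain ⟨k, hk⟩ := exists_pow_pos hirr i j
  have hpow : ∀ s, 0 ≤ (P ^ k) s j := fun s => pow_apply_nonneg hirr.nonneg k s j
  rw [← vecMul_pow_eq_self hv k]
  exact sum_pos' (fun s _ => mul_nonneg (hnn s) (hpow s))
    ⟨i, mem_univ i, mul_pos ((hnn i).lt_of_ne' hi) hk⟩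

variable [DecidableEq S]

lemma eq_of_mulVec_eq_self (hP : P ∈ rowStochastic ℝ S) (hirr : P.IsIrreducible) {f : S → ℝ}
    (hf : P *ᵥ f = f) (i j : S) : f i = f j := by
  have : Nonempty S := ⟨i⟩
  obtain ⟨m, hm⟩ := Finite.exists_max f
  suffices h : ∀ l, f l = f m from (h i).trans (h j).symm
  intro l
  obtain ⟨k, hk⟩ := exists_pow_pos hirr m l
  have hPk : P ^ k ∈ rowStochastic ℝ S := pow_mem hP k
  have hsum : ∑ s, (P ^ k) m s * (f m - f s) = 0 := by
    have hfm : ∑ s, (P ^ k) m s * f s = f m := congrFun (pow_mulVec_eq_self hf k) m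
    simp only [mul_sub, sum_sub_distrib, ← sum_mul, sum_row_of_mem_rowStochastic hPk, hfm,
      one_mul, sub_self]
  have hterm := (sum_eq_zero_iff_of_nonneg fun s _ =>
    mul_nonneg (hPk.1 m s) (sub_nonneg.mpr (hm s))).mp hsum l (mem_univ l)
  linarith [(mul_eq_zero.mp hterm).resolve_left hk.ne']

lemma exists_vecMul_eq_self [Nonempty S] (hP : P ∈ rowStochastic ℝ S) :
    ∃ v ≠ 0, v ᵥ* P = v := by
  have hdet : (1 - P).det = 0 :=
    exists_mulVec_eq_zero_iff.mp ⟨1, one_ne_zero, by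
      rw [sub_mulVec, one_mulVec, one_vecMul_of_mem_rowStochastic hP, sub_self]⟩
  obtain ⟨v, hv0, hv⟩ := exists_vecMul_eq_zero_iff.mpr hdet
  exact ⟨v, hv0, by rwa [vecMul_sub, vecMul_one, sub_eq_zero, eq_comm] at hv⟩

lemma abs_vecMul_eq_self (hP : P ∈ rowStochastic ℝ S) {v : S → ℝ} (hv : v ᵥ* P = v) :
    |v| ᵥ* P = |v| := by
  have hle : ∀ j, |v| j ≤ (|v| ᵥ* P) j := fun j => calc
    |v| j = |∑ i, v i * P i j| := congrArg (fun w : S → ℝ => |w j|) hv.symm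
    _ ≤ ∑ i, |v i * P i j| := abs_sum_le_sum_abs _ _
    _ = (|v| ᵥ* P) j := sum_congr rfl fun i _ => by
      rw [abs_mul, abs_of_nonneg (hP.1 i j), Pi.abs_apply]
  have hsum : ∑ j, |v| j = ∑ j, (|v| ᵥ* P) j := by
    have := Matrix.dotProduct_mulVec |v| P 1
    rwa [hP.2, dotProduct_one, dotProduct_one] at this
  exact funext fun j =>
    ((sum_eq_sum_iff_of_le fun j _ => hle j).mp hsum j (mem_univ j)).symm

lemma exists_isPositiveStationary [Nonempty S] (hP : P ∈ rowStochastic ℝ S)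
    (hirr : P.IsIrreducible) : ∃ π, IsPositiveStationary P π := by
  obtain ⟨v, hv0, hv⟩ := exists_vecMul_eq_self hP
  have habs := abs_vecMul_eq_self hP hv
  have hpos : ∀ j, 0 < |v| j :=
    pos_of_vecMul_eq_self hirr habs (by simpa using hv0) (abs_nonneg v)
  have htot : 0 < ∑ j, |v| j := sum_pos (fun j _ => hpos j) univ_nonempty
  refine ⟨(∑ j, |v| j)⁻¹ • |v|, fun j => mul_pos (inv_pos.mpr htot) (hpos j), ?_, ?_⟩
  · simp only [Pi.smul_apply, smul_eq_mul, ← mul_sum, inv_mul_cancel₀ htot.ne']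
  · rw [smul_vecMul, habs]

lemma IsPositiveStationary.exists_sub_mulVec_eq (hπ : IsPositiveStationary P π)
    (hP : P ∈ rowStochastic ℝ S) (hirr : P.IsIrreducible) (f : S → ℝ) :
    ∃ h : S → ℝ, h - P *ᵥ h = f - (π ⬝ᵥ f) • 1 := by
  -- `h ↦ h - P *ᵥ h` kills the constants; adding `π ⬝ᵥ h` makes it injective, hence surjective.
  let T : (S → ℝ) →ₗ[ℝ] (S → ℝ) :=
    { toFun := fun h => h - P *ᵥ h + (π ⬝ᵥ h) • 1
      map_add' := fun g h => by rw [mulVec_add, dotProduct_add]; module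
      map_smul' := fun c h => by
        rw [mulVec_smul, dotProduct_smul, RingHom.id_apply, smul_eq_mul]; module }
  have hT : ∀ h, T h = h - P *ᵥ h + (π ⬝ᵥ h) • 1 := fun _ => rfl
  have hπT : ∀ h, π ⬝ᵥ T h = π ⬝ᵥ h := fun h => by
    rw [hT, dotProduct_add, dotProduct_sub, hπ.dotProduct_mulVec, dotProduct_smul, dotProduct_one,
      hπ.sum_eq_one, sub_self, zero_add, smul_eq_mul, mul_one]
  have hinj : Function.Injective T := by
    refine (injective_iff_map_eq_zero T).mpr fun h hh => ?_
    have hπh : π ⬝ᵥ h = 0 := by rw [← hπT, hh, dotProduct_zero]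
    have hharm : P *ᵥ h = h := by
      rw [hT, hπh, zero_smul, add_zero, sub_eq_zero] at hh
      exact hh.symm
    funext i
    have hconst : π ⬝ᵥ h = h i := by
      simp only [dotProduct, eq_of_mulVec_eq_self hP hirr hharm _ i, ← sum_mul, hπ.sum_eq_one,
        one_mul]
    exact hconst.symm.trans hπh
  obtain ⟨h, rfl⟩ := LinearMap.injective_iff_surjective.mp hinj f
  exact ⟨h, by rw [hπT, hT, add_sub_cancel_right]⟩

end StochasticMatrix

section MartingaleDifference

variable {Ω : Type*} {mΩ : MeasurableSpace Ω} {μ : Measure Ω}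

lemma ae_tendsto_zero_of_summable_integral_sq {Z : ℕ → Ω → ℝ} (hZ : ∀ n, Measurable (Z n))
    (hint : ∀ n, Integrable (fun ω => Z n ω ^ 2) μ)
    (hsum : Summable fun n => ∫ ω, Z n ω ^ 2 ∂μ) :
    ∀ᵐ ω ∂μ, Tendsto (fun n => Z n ω) atTop (𝓝 0) := by
  have hmeas : ∀ n, Measurable fun ω => ENNReal.ofReal (Z n ω ^ 2) := fun n =>
    ((hZ n).pow_const 2).ennreal_ofReal
  have htotal : ∫⁻ ω, ∑' n, ENNReal.ofReal (Z n ω ^ 2) ∂μ ≠ ⊤ := by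
    rw [lintegral_tsum fun n => (hmeas n).aemeasurable]
    simp only [← ofReal_integral_eq_lintegral_ofReal (hint _) (.of_forall fun _ => sq_nonneg _)]
    exact hsum.tsum_ofReal_ne_top
  filter_upwards [ae_lt_top (Measurable.tsum hmeas) htotal] with ω hω
  have hsq : Tendsto (fun n => Z n ω ^ 2) atTop (𝓝 0) :=
    ((ENNReal.tendsto_toReal ENNReal.zero_ne_top).comp
      (ENNReal.tendsto_atTop_zero_of_tsum_ne_top hω.ne)).congr fun n =>
        ENNReal.toReal_ofReal (sq_nonneg _)
  refine (tendsto_zero_iff_abs_tendsto_zero _).mpr ?_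
  simpa only [Real.sqrt_zero, Real.sqrt_sq_eq_abs, Function.comp_def] using hsq.sqrt

lemma tendsto_div_of_tendsto_sq_of_monotone {u : ℕ → ℝ} {l : ℝ} (hu : Monotone u)
    (h : Tendsto (fun n : ℕ => u (n ^ 2) / (n ^ 2 : ℕ)) atTop (𝓝 l)) :
    Tendsto (fun n => u n / n) atTop (𝓝 l) := by
  refine tendsto_div_of_monotone_of_exists_subseq_tendsto_div u l hu fun a ha =>
    ⟨fun n => n ^ 2, ?_, tendsto_pow_atTop two_ne_zero, h⟩
  have hlarge : ∀ᶠ n : ℕ in atTop, 3 ≤ (n : ℝ) * (a - 1) :=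
    (tendsto_natCast_atTop_atTop.atTop_mul_const (sub_pos.mpr ha)).eventually_ge_atTop 3
  filter_upwards [hlarge, eventually_ge_atTop 1] with n hn hn1
  have hn1' : (1 : ℝ) ≤ n := by exact_mod_cast hn1
  push_cast
  nlinarith

lemma tendsto_div_of_tendsto_sq {u : ℕ → ℝ} {c l : ℝ} (hu : ∀ n, |u (n + 1) - u n| ≤ c)
    (h : Tendsto (fun n : ℕ => u (n ^ 2) / (n ^ 2 : ℕ)) atTop (𝓝 l)) :
    Tendsto (fun n => u n / n) atTop (𝓝 l) := by
  have hmono : Monotone fun n => u n + c * n := monotone_nat_of_le_succ fun n => by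
    push_cast
    linarith [(abs_le.mp (hu n)).1]
  have hdiv : ∀ n : ℕ, 1 ≤ n → u n / n + c = (u n + c * n) / n := fun n hn => by
    have : (n : ℝ) ≠ 0 := by positivity
    field_simp
  have hsq : Tendsto (fun n : ℕ => (u (n ^ 2) + c * (n ^ 2 : ℕ)) / (n ^ 2 : ℕ)) atTop
      (𝓝 (l + c)) := by
    refine (h.add_const c).congr' ?_
    filter_upwards [eventually_ge_atTop 1] with n hn using hdiv (n ^ 2) (Nat.one_le_pow _ _ hn)
  have hlim := (tendsto_div_of_tendsto_sq_of_monotone hmono hsq).sub_const c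
  rw [add_sub_cancel_right] at hlim
  refine hlim.congr' ?_
  filter_upwards [eventually_ge_atTop 1] with n hn
  rw [← hdiv n hn, add_sub_cancel_right]

/-- A sequence of martingale differences bounded by `c`: the increment `ξ n` between the times `n`
and `n + 1` is known at time `n + 1` and has mean zero given the past up to time `n`. -/
structure IsBoundedMartingaleDifference (μ : Measure Ω) (ℱ : Filtration ℕ mΩ) (ξ : ℕ → Ω → ℝ)
    (c : ℝ) : Prop where
  stronglyMeasurable : ∀ n, StronglyMeasurable[ℱ (n + 1)] (ξ n)
  condExp_eq_zero : ∀ n, μ[ξ n | ℱ n] =ᵐ[μ] 0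
  abs_apply_le : ∀ n ω, |ξ n ω| ≤ c

namespace IsBoundedMartingaleDifference

variable {ℱ : Filtration ℕ mΩ} {ξ : ℕ → Ω → ℝ} {c : ℝ}

lemma stronglyMeasurable_sum (hξ : IsBoundedMartingaleDifference μ ℱ ξ c) (n : ℕ) :
    StronglyMeasurable[ℱ n] fun ω => ∑ k ∈ range n, ξ k ω :=
  Finset.stronglyMeasurable_fun_sum _ fun k hk =>
    (hξ.stronglyMeasurable k).mono (ℱ.mono (mem_range.mp hk))

lemma integrable_mul (hξ : IsBoundedMartingaleDifference μ ℱ ξ c) {g : Ω → ℝ}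
    (hg : Integrable g μ) (n : ℕ) : Integrable (fun ω => g ω * ξ n ω) μ :=
  hg.mul_bdd (c := c) ((hξ.stronglyMeasurable n).mono (ℱ.le _)).aestronglyMeasurable
    (.of_forall fun ω => hξ.abs_apply_le n ω)

variable [IsFiniteMeasure μ]

lemma integrable (hξ : IsBoundedMartingaleDifference μ ℱ ξ c) (n : ℕ) : Integrable (ξ n) μ :=
  .of_bound ((hξ.stronglyMeasurable n).mono (ℱ.le _)).aestronglyMeasurable c
    (.of_forall fun ω => hξ.abs_apply_le n ω)

lemma integrable_sum (hξ : IsBoundedMartingaleDifference μ ℱ ξ c) (n : ℕ) :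
    Integrable (fun ω => ∑ k ∈ range n, ξ k ω) μ :=
  integrable_finsetSum _ fun k _ => hξ.integrable k

lemma integrable_sum_sq (hξ : IsBoundedMartingaleDifference μ ℱ ξ c) (n : ℕ) :
    Integrable (fun ω => (∑ k ∈ range n, ξ k ω) ^ 2) μ := by
  simp only [sq, mul_sum (range n) _ (∑ k ∈ range n, ξ k _)]
  exact integrable_finsetSum _ fun k _ => hξ.integrable_mul (hξ.integrable_sum n) k

lemma integral_sum_mul_eq_zero (hξ : IsBoundedMartingaleDifference μ ℱ ξ c) (n : ℕ) :
    ∫ ω, (∑ k ∈ range n, ξ k ω) * ξ n ω ∂μ = 0 := by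
  have hpull := condExp_mul_of_stronglyMeasurable_left (hξ.stronglyMeasurable_sum n)
    (hξ.integrable_mul (hξ.integrable_sum n) n) (hξ.integrable n)
  have hzero := hpull.trans ((hξ.condExp_eq_zero n).mono fun ω hω => by
    rw [Pi.mul_apply, hω, Pi.zero_apply, mul_zero])
  have := integral_condExp (μ := μ) (f := (fun ω => ∑ k ∈ range n, ξ k ω) * ξ n) (ℱ.le n)
  rw [integral_congr_ae hzero, integral_zero] at this
  exact this.symm

lemma integral_sum_sq_le (hξ : IsBoundedMartingaleDifference μ ℱ ξ c) (n : ℕ) :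
    ∫ ω, (∑ k ∈ range n, ξ k ω) ^ 2 ∂μ ≤ n * (c ^ 2 * μ.real Set.univ) := by
  induction n with
  | zero => simp
  | succ n ih =>
    have hsq : Integrable (fun ω => ξ n ω ^ 2) μ := by
      simpa only [sq] using hξ.integrable_mul (hξ.integrable n) n
    have hlast : ∫ ω, ξ n ω ^ 2 ∂μ ≤ c ^ 2 * μ.real Set.univ := calc
      ∫ ω, ξ n ω ^ 2 ∂μ ≤ ∫ _, c ^ 2 ∂μ := integral_mono hsq (integrable_const _) fun ω =>
        sq_le_sq' (abs_le.mp (hξ.abs_apply_le n ω)).1 (abs_le.mp (hξ.abs_apply_le n ω)).2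
      _ = c ^ 2 * μ.real Set.univ := by rw [integral_const, smul_eq_mul, mul_comm]
    calc ∫ ω, (∑ k ∈ range (n + 1), ξ k ω) ^ 2 ∂μ
        = ∫ ω, ((∑ k ∈ range n, ξ k ω) ^ 2 + 2 * ((∑ k ∈ range n, ξ k ω) * ξ n ω)
          + ξ n ω ^ 2) ∂μ := by
          congr! 2 with ω
          rw [sum_range_succ]
          ring
      _ = ∫ ω, (∑ k ∈ range n, ξ k ω) ^ 2 ∂μ + ∫ ω, ξ n ω ^ 2 ∂μ := by
          have hcross := (hξ.integrable_mul (hξ.integrable_sum n) n).const_mul 2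
          rw [integral_add (f := fun ω => _ + _) ((hξ.integrable_sum_sq n).add hcross) hsq,
            integral_add (hξ.integrable_sum_sq n) hcross, integral_const_mul,
            hξ.integral_sum_mul_eq_zero, mul_zero, add_zero]
      _ ≤ n * (c ^ 2 * μ.real Set.univ) + c ^ 2 * μ.real Set.univ := add_le_add ih hlast
      _ = ((n + 1 : ℕ) : ℝ) * (c ^ 2 * μ.real Set.univ) := by push_cast; ring

theorem ae_tendsto_sum_div (hξ : IsBoundedMartingaleDifference μ ℱ ξ c) :
    ∀ᵐ ω ∂μ, Tendsto (fun n : ℕ => (∑ k ∈ range n, ξ k ω) / n) atTop (𝓝 0) := by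
  have hle : ∀ n : ℕ, ∫ ω, ((∑ k ∈ range (n ^ 2), ξ k ω) / (n ^ 2 : ℕ)) ^ 2 ∂μ
      ≤ c ^ 2 * μ.real Set.univ * (1 / (n : ℝ) ^ 2) := fun n => by
    simp only [div_pow, integral_div]
    calc (∫ ω, (∑ k ∈ range (n ^ 2), ξ k ω) ^ 2 ∂μ) / ((n ^ 2 : ℕ) : ℝ) ^ 2
        ≤ (n ^ 2 : ℕ) * (c ^ 2 * μ.real Set.univ) / ((n ^ 2 : ℕ) : ℝ) ^ 2 := by
          gcongr
          exact hξ.integral_sum_sq_le _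
      _ = c ^ 2 * μ.real Set.univ * (1 / (n : ℝ) ^ 2) := by
          rcases eq_or_ne n 0 with rfl | hn
          · simp
          · push_cast
            field_simp
  have hsum : Summable fun n : ℕ =>
      ∫ ω, ((∑ k ∈ range (n ^ 2), ξ k ω) / (n ^ 2 : ℕ)) ^ 2 ∂μ :=
    .of_nonneg_of_le (fun n => integral_nonneg fun _ => sq_nonneg _) hle
      ((Real.summable_one_div_nat_pow.mpr one_lt_two).mul_left _)
  filter_upwards [ae_tendsto_zero_of_summable_integral_sq
    (fun n => ((hξ.stronglyMeasurable_sum (n ^ 2)).mono (ℱ.le _)).measurable.div_const _)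
    (fun n => by simpa only [div_pow] using (hξ.integrable_sum_sq (n ^ 2)).div_const _)
    hsum] with ω hω
  exact tendsto_div_of_tendsto_sq
    (fun n => by rw [sum_range_succ, add_sub_cancel_left]; exact hξ.abs_apply_le n ω) hω

end IsBoundedMartingaleDifference

end MartingaleDifference

section MarkovChain

variable {Ω S : Type*} {mΩ : MeasurableSpace Ω} {μ : Measure Ω} [Fintype S]
  {ℱ : Filtration ℕ mΩ} {P : Matrix S S ℝ} {Y : ℕ → Ω → S}

/-- `Y` is a Markov chain on the finite set `S`, with transition matrix `P` and with respect to the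
filtration `ℱ`. The Markov property is tested against arbitrary functions on `S`. -/
structure IsMarkovChain (μ : Measure Ω) (ℱ : Filtration ℕ mΩ) (P : Matrix S S ℝ)
    (Y : ℕ → Ω → S) : Prop where
  measurable : ∀ n, Measurable[ℱ n, ⊤] (Y n)
  condExp_eq : ∀ n (φ : S → ℝ),
    μ[fun ω => φ (Y (n + 1) ω) | ℱ n] =ᵐ[μ] fun ω => (P *ᵥ φ) (Y n ω)

namespace IsMarkovChain

lemma stronglyMeasurable_comp (hY : IsMarkovChain μ ℱ P Y) (φ : S → ℝ) (n : ℕ) :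
    StronglyMeasurable[ℱ n] fun ω => φ (Y n ω) :=
  (measurable_from_top.comp (hY.measurable n)).stronglyMeasurable

variable [IsFiniteMeasure μ]

lemma exists_isBoundedMartingaleDifference (hY : IsMarkovChain μ ℱ P Y) (h : S → ℝ) :
    ∃ c, IsBoundedMartingaleDifference μ ℱ
      (fun n ω => h (Y (n + 1) ω) - (P *ᵥ h) (Y n ω)) c := by
  obtain ⟨C, hC⟩ := (Set.finite_range fun st : S × S => |h st.1 - (P *ᵥ h) st.2|).bddAbove
  have hint : ∀ (φ : S → ℝ) n, Integrable (fun ω => φ (Y n ω)) μ := fun φ n => by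
    obtain ⟨B, hB⟩ := (Set.finite_range fun s => ‖φ s‖).bddAbove
    exact .of_bound ((hY.stronglyMeasurable_comp φ n).mono (ℱ.le n)).aestronglyMeasurable B
      (.of_forall fun ω => hB ⟨Y n ω, rfl⟩)
  refine ⟨C, fun n => ?_, fun n => ?_, fun n ω => hC ⟨(Y (n + 1) ω, Y n ω), rfl⟩⟩
  · exact (hY.stronglyMeasurable_comp h (n + 1)).sub
      ((hY.stronglyMeasurable_comp _ n).mono (ℱ.mono n.le_succ))
  · have hpast : μ[fun ω => (P *ᵥ h) (Y n ω) | ℱ n] = fun ω => (P *ᵥ h) (Y n ω) :=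
      condExp_of_stronglyMeasurable (ℱ.le n) (hY.stronglyMeasurable_comp _ n) (hint _ n)
    filter_upwards [condExp_sub (hint h (n + 1)) (hint (P *ᵥ h) n) (ℱ n), hY.condExp_eq n h]
      with ω hsub hstep
    exact hsub.trans (by rw [Pi.sub_apply, hstep, hpast, sub_self, Pi.zero_apply])

lemma ae_tendsto_average_of_sub_mulVec_eq (hY : IsMarkovChain μ ℱ P Y) {f h : S → ℝ}
    (hfh : h - P *ᵥ h = f) :
    ∀ᵐ ω ∂μ, Tendsto (fun n : ℕ => (∑ k ∈ range n, f (Y k ω)) / n) atTop (𝓝 0) := by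
  obtain ⟨c, hξ⟩ := hY.exists_isBoundedMartingaleDifference h
  have hsum : ∀ n ω, ∑ k ∈ range n, f (Y k ω) =
      (∑ k ∈ range n, (h (Y (k + 1) ω) - (P *ᵥ h) (Y k ω))) + (h (Y 0 ω) - h (Y n ω)) :=
    fun n ω => by
      rw [← sum_range_sub' (fun k => h (Y k ω)), ← sum_add_distrib]
      simp only [← hfh, Pi.sub_apply, sub_add_sub_cancel']
  obtain ⟨C, hC⟩ := (Set.finite_range fun st : S × S => |h st.1 - h st.2|).bddAbove
  filter_upwards [hξ.ae_tendsto_sum_div] with ω hω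
  have hboundary : Tendsto (fun n : ℕ => (h (Y 0 ω) - h (Y n ω)) / n) atTop (𝓝 0) :=
    squeeze_zero_norm (fun n => by
      rw [norm_div, Real.norm_eq_abs, Real.norm_natCast]
      gcongr
      exact hC ⟨(Y 0 ω, Y n ω), rfl⟩) (tendsto_const_div_atTop_nhds_zero_nat C)
  simpa only [hsum, add_div, add_zero] using hω.add hboundary

variable [DecidableEq S]

theorem ae_tendsto_average (hY : IsMarkovChain μ ℱ P Y) (hP : P ∈ rowStochastic ℝ S)
    (hirr : P.IsIrreducible) {π : S → ℝ} (hπ : IsPositiveStationary P π) (f : S → ℝ) :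
    ∀ᵐ ω ∂μ, Tendsto (fun n : ℕ => (∑ k ∈ range n, f (Y k ω)) / n) atTop (𝓝 (π ⬝ᵥ f)) := by
  obtain ⟨h, hh⟩ := hπ.exists_sub_mulVec_eq hP hirr f
  filter_upwards [hY.ae_tendsto_average_of_sub_mulVec_eq hh] with ω hω
  refine ((hω.add_const (π ⬝ᵥ f)).congr' ?_).trans (by rw [zero_add])
  filter_upwards [eventually_ge_atTop 1] with n hn
  have hn0 : (n : ℝ) ≠ 0 := by positivity
  simp only [Pi.sub_apply, Pi.smul_apply, Pi.one_apply, smul_eq_mul, mul_one, sum_sub_distrib,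
    sum_const, card_range, nsmul_eq_mul]
  field_simp
  ring

end IsMarkovChain

end MarkovChain

section State

variable {L : ℕ}

/-- The state after the step `ε` from the state `η`: the coordinates of `η` move up by one place
and the last one is forgotten. -/
def push (ε : ℤˣ) (η : State L) : State L := fun i =>
  if (i : ℕ) = 0 then ε else η ⟨i - 1, (Nat.sub_le _ _).trans_lt i.2⟩

lemma push_neg (ε : ℤˣ) (η : State L) : push (-ε) (-η) = -push ε η := by
  funext i
  exact (apply_ite Neg.neg _ _ _).symm

lemma push_mono {ε δ : ℤˣ} {η ζ : State L} (hεδ : ε ≤ δ) (hηζ : η ≤ ζ) : push ε η ≤ push δ ζ := by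
  intro i
  unfold push
  split_ifs
  exacts [hεδ, hηζ _]

lemma iterate_push_eq_const (ε : ℤˣ) (η : State L) : (push ε)^[L] η = fun _ => ε := by
  suffices h : ∀ k, ∀ i : Fin L, (i : ℕ) < k → (push ε)^[k] η i = ε from
    funext fun i => h L i i.2
  intro k
  induction k with
  | zero => exact fun _ hi => absurd hi (Nat.not_lt_zero _)
  | succ k ih =>
    intro i hi
    rw [Function.iterate_succ_apply']
    unfold push
    split_ifs
    · rfl
    · exact ih _ (by simp only; omega)

lemma mem_of_push_mem {T : Set (State L)} (hne : T.Nonempty) (hT : ∀ ε, ∀ η ∈ T, push ε η ∈ T)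
    (ζ : State L) : ζ ∈ T := by
  -- Starting anywhere in `T`, push the coordinates of `ζ`, the oldest one first.
  have hsuffix : ∀ j ≤ L, ∃ η ∈ T, ∀ i k : Fin L, (i : ℕ) < j → (k : ℕ) + j = i + L →
      η i = ζ k := by
    intro j
    induction j with
    | zero => exact fun _ => hne.imp fun η hη => ⟨hη, fun _ _ hi => absurd hi (Nat.not_lt_zero _)⟩
    | succ j ih =>
      intro hj
      obtain ⟨η, hη, hηζ⟩ := ih (by omega)
      refine ⟨push (ζ ⟨L - (j + 1), by omega⟩) η, hT _ _ hη, fun i k _ hk => ?_⟩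
      unfold push
      split_ifs with h0
      · congr 1
        ext
        simp only
        omega
      · exact hηζ _ _ (by simp only; omega) (by simp only; omega)
  obtain ⟨η, hη, hηζ⟩ := hsuffix L le_rfl
  rwa [← funext fun i => hηζ i i i.2 rfl]

@[simp] lemma partialSum_zero (η : State L) : partialSum η 0 = 0 := by
  simp [partialSum]

lemma partialSum_succ (η : State L) {j : ℕ} (hj : j < L) :
    partialSum η (j + 1) = partialSum η j + η ⟨j, hj⟩ := by
  have hcoord : ((η ⟨j, hj⟩ : ℤˣ) : ℤ) = ∑ i : Fin L, if i = ⟨j, hj⟩ then (η i : ℤ) else 0 := by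
    simp
  unfold partialSum
  rw [hcoord, ← sum_add_distrib]
  refine sum_congr rfl fun i _ => ?_
  simp only [Fin.ext_iff]
  split_ifs <;> omega

lemma partialSum_push (ε : ℤˣ) (η : State L) {j : ℕ} (hj : j < L) :
    partialSum (push ε η) (j + 1) = ε + partialSum η j := by
  induction j with
  | zero => simp [partialSum_succ _ hj, push]
  | succ j ih =>
    rw [partialSum_succ _ hj, ih (by omega), partialSum_succ η (by omega : j < L), add_assoc]
    simp [push]

lemma partialSum_neg (η : State L) (j : ℕ) : partialSum (-η) j = -partialSum η j := by
  unfold partialSum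
  rw [← sum_neg_distrib]
  refine sum_congr rfl fun i _ => ?_
  split_ifs <;> simp

lemma partialSum_mono (j : ℕ) : Monotone fun η : State L => partialSum η j := by
  intro η ζ h
  refine sum_le_sum fun i _ => ?_
  split_ifs
  exacts [Units.val_le_val.mpr (h i), le_rfl]

lemma isLocMax_neg (η : State L) : IsLocMax (-η) ↔ IsLocMin η := by
  simp [IsLocMax, IsLocMin, partialSum_neg]

lemma isLocMin_neg (η : State L) : IsLocMin (-η) ↔ IsLocMax η := by
  simp [IsLocMax, IsLocMin, partialSum_neg]

lemma isLocMin_neg_one : IsLocMin (-1 : State L) := fun j _ _ => by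
  refine sum_nonpos fun i _ => ?_
  split_ifs <;> simp

lemma IsLocMax.not_isLocMin (hL : 1 ≤ L) {η : State L} (hmax : IsLocMax η) : ¬IsLocMin η := by
  intro hmin
  have h0 : partialSum η 1 = 0 := le_antisymm (hmin 1 le_rfl hL) (hmax 1 le_rfl hL)
  rw [partialSum_succ η (by omega : 0 < L)] at h0
  simp at h0

open Classical in
/-- The probability of a step to the right from the state `η`. For `1 ≤ L` no state is both a local
maximum and a local minimum, so the order of the two cases does not matter. -/
noncomputable def upProb (p q : ℝ) (η : State L) : ℝ :=
  if IsLocMax η then p else if IsLocMin η then q else 1 / 2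

lemma upProb_mem_Ioo {p q : ℝ} (hp : p ∈ Set.Ioo 0 1) (hq : q ∈ Set.Ioo 0 1) (η : State L) :
    upProb p q η ∈ Set.Ioo 0 1 := by
  unfold upProb
  split_ifs
  exacts [hp, hq, ⟨by norm_num, by norm_num⟩]

lemma upProb_neg (hL : 1 ≤ L) (p : ℝ) (η : State L) :
    upProb p (1 - p) (-η) = 1 - upProb p (1 - p) η := by
  have := IsLocMax.not_isLocMin hL (η := η)
  unfold upProb
  rw [isLocMax_neg, isLocMin_neg]
  split_ifs <;> first | tauto | norm_num

open Classical in
lemma upProb_sub_upProb (hL : 1 ≤ L) (p q q' : ℝ) (η : State L) :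
    upProb p q η - upProb p q' η = if IsLocMin η then q - q' else 0 := by
  have := IsLocMax.not_isLocMin hL (η := η)
  unfold upProb
  split_ifs <;> first | tauto | ring

section Monotonicity

variable {p : ℝ} {η ζ : State L}

lemma IsLocMax.of_partialSum_le (hη : IsLocMax η)
    (hle : ∀ j ≤ L, partialSum η j ≤ partialSum ζ j) : IsLocMax ζ :=
  fun j h1 hj => (hη j h1 hj).trans (hle j hj)

lemma IsLocMin.of_partialSum_le (hζ : IsLocMin ζ)
    (hle : ∀ j ≤ L, partialSum η j ≤ partialSum ζ j) : IsLocMin η :=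
  fun j h1 hj => (hle j hj).trans (hζ j h1 hj)

lemma upProb_le_upProb (hp : 1 / 2 ≤ p) (hle : ∀ j ≤ L, partialSum η j ≤ partialSum ζ j) :
    upProb p (1 - p) η ≤ upProb p (1 - p) ζ := by
  have hmax : IsLocMax η → IsLocMax ζ := fun h => h.of_partialSum_le hle
  have hmin : IsLocMin ζ → IsLocMin η := fun h => h.of_partialSum_le hle
  unfold upProb
  split_ifs <;> first | tauto | linarith

lemma upProb_le_upProb_of_le_half (hp : p ≤ 1 / 2)
    (hle : ∀ j ≤ L, partialSum η j ≤ partialSum ζ j) :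
    upProb p (1 - p) ζ ≤ upProb p (1 - p) η := by
  have hmax : IsLocMax η → IsLocMax ζ := fun h => h.of_partialSum_le hle
  have hmin : IsLocMin ζ → IsLocMin η := fun h => h.of_partialSum_le hle
  unfold upProb
  split_ifs <;> first | tauto | linarith

end Monotonicity

lemma sum_mul_upProb_eq_speed (hL : 1 ≤ L) (p q : ℝ) (π : State L → ℝ) :
    ∑ η, π η * (2 * upProb p q η - 1) = speed p q π := by
  classical
  unfold speed massMax massMin
  rw [mul_sum, mul_sum, ← sum_add_distrib]
  refine sum_congr rfl fun η _ => ?_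
  have := IsLocMax.not_isLocMin hL (η := η)
  unfold upProb
  split_ifs <;> first | tauto | ring

end State

section StepMatrix

variable {L : ℕ} {u : State L → ℝ}

/-- The transition matrix of the chain of the last `L` steps of a walk that steps to the right from
the state `η` with probability `u η`. For `L = 0` the two entries of a row coincide, so they are
added. -/
noncomputable def stepMatrix (u : State L → ℝ) : Matrix (State L) (State L) ℝ := fun η ζ =>
  (if ζ = push 1 η then u η else 0) + if ζ = push (-1) η then 1 - u η else 0

lemma stepMatrix_mulVec (f : State L → ℝ) (η : State L) :
    (stepMatrix u *ᵥ f) η = u η * f (push 1 η) + (1 - u η) * f (push (-1) η) := by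
  simp only [mulVec, dotProduct, stepMatrix, add_mul, sum_add_distrib, ite_mul, zero_mul,
    sum_ite_eq', mem_univ, if_true]

lemma stepMatrix_mulVec_comp_neg (hodd : ∀ η, u (-η) = 1 - u η) (f : State L → ℝ) (η : State L) :
    (stepMatrix u *ᵥ fun ζ => f (-ζ)) η = (stepMatrix u *ᵥ f) (-η) := by
  rw [stepMatrix_mulVec, stepMatrix_mulVec, hodd, ← push_neg, ← push_neg, neg_neg]
  ring

lemma stepMatrix_nonneg (hu : ∀ η, u η ∈ Set.Ioo 0 1) (η ζ : State L) : 0 ≤ stepMatrix u η ζ := by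
  have := hu η
  unfold stepMatrix
  split_ifs <;> linarith [this.1, this.2]

lemma stepMatrix_mem_rowStochastic (hu : ∀ η, u η ∈ Set.Ioo 0 1) :
    stepMatrix u ∈ rowStochastic ℝ (State L) :=
  ⟨stepMatrix_nonneg hu, funext fun η => by rw [stepMatrix_mulVec]; simp⟩

lemma stepMatrix_push_pos (hu : ∀ η, u η ∈ Set.Ioo 0 1) (ε : ℤˣ) (η : State L) :
    0 < stepMatrix u η (push ε η) := by
  have := hu η
  unfold stepMatrix
  rcases Int.units_eq_one_or ε with rfl | rfl <;> split_ifs <;> first | tauto |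
    linarith [this.1, this.2]

lemma stepMatrix_isIrreducible (hu : ∀ η, u η ∈ Set.Ioo 0 1) : (stepMatrix u).IsIrreducible := by
  refine (isIrreducible_iff_exists_pow_pos (stepMatrix_nonneg hu)).mpr fun η =>
    mem_of_push_mem (T := {ζ | ∃ k > 0, 0 < (stepMatrix u ^ k) η ζ})
      ⟨push 1 η, 1, one_pos, by rw [pow_one]; exact stepMatrix_push_pos hu 1 η⟩ ?_
  rintro ε ξ ⟨k, -, hk⟩
  refine ⟨k + 1, k.succ_pos, ?_⟩
  rw [pow_succ, mul_apply]
  exact sum_pos' (fun ζ _ =>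
      mul_nonneg (pow_apply_nonneg (stepMatrix_nonneg hu) k η ζ) (stepMatrix_nonneg hu _ _))
    ⟨ξ, mem_univ ξ, mul_pos hk (stepMatrix_push_pos hu ε ξ)⟩

lemma exists_sub_stepMatrix_mulVec_eq_drift (hu : ∀ η, u η ∈ Set.Ioo 0 1)
    (hodd : ∀ η, u (-η) = 1 - u η) :
    ∃ h : State L → ℝ, h - stepMatrix u *ᵥ h = fun η => 2 * u η - 1 := by
  have hP := stepMatrix_mem_rowStochastic hu
  have hirr := stepMatrix_isIrreducible hu
  obtain ⟨π, hπ⟩ := exists_isPositiveStationary hP hirr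
  set d : State L → ℝ := fun η => 2 * u η - 1 with hd
  obtain ⟨h, hh⟩ := hπ.exists_sub_mulVec_eq hP hirr d
  -- The drift is odd, so it cancels in the equation for the even function `h + h ∘ neg`.
  have heven : (h + fun η => h (-η)) - stepMatrix u *ᵥ (h + fun η => h (-η)) =
      (-2 * (π ⬝ᵥ d)) • 1 := by
    funext η
    have hη := congrFun hh η
    have hnη := congrFun hh (-η)
    rw [mulVec_add]
    simp only [hd, Pi.sub_apply, Pi.add_apply, Pi.smul_apply, Pi.one_apply, smul_eq_mul,
      stepMatrix_mulVec_comp_neg hodd, hodd] at hη hnη ⊢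
    linarith
  have hmean := congrArg (π ⬝ᵥ ·) heven
  simp only [dotProduct_sub, hπ.dotProduct_mulVec, sub_self, dotProduct_smul, dotProduct_one,
    hπ.sum_eq_one, smul_eq_mul] at hmean
  have hmean_drift : π ⬝ᵥ d = 0 := by linarith
  exact ⟨h, by rw [hh, hmean_drift, zero_smul, sub_zero]⟩

end StepMatrix

section Coupling

variable {L : ℕ} {u h : State L → ℝ}

/-- The relation `R e η ζ` between two walks that step to the right with probability `u`, the first
being in the state `η`, at present `2 * e` to the right of the second, which is in the state `ζ`:
the two walks can be run together without violating `R`. If `u ζ ≤ u η`, the second walk steps to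
the right only if the first does; otherwise all four pairs of steps have to be admissible. -/
structure IsCoupling (u : State L → ℝ) (R : ℕ → State L → State L → Prop) : Prop where
  up_up : ∀ {e η ζ}, R e η ζ → R e (push 1 η) (push 1 ζ)
  down_down : ∀ {e η ζ}, R e η ζ → R e (push (-1) η) (push (-1) ζ)
  up_down : ∀ {e η ζ}, R e η ζ → R (e + 1) (push 1 η) (push (-1) ζ)
  down_up : ∀ {e η ζ}, R e η ζ → u η < u ζ → ∃ e', e = e' + 1 ∧ R e' (push (-1) η) (push 1 ζ)

/-- For a solution `h` of the Poisson equation of the drift, the expected final distance of two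
walks at distance `2 * e` in the states `η` and `ζ`: it is preserved on average by any joint
step. -/
def gap (h : State L → ℝ) (e : ℕ) (η ζ : State L) : ℝ :=
  2 * e + h η - h ζ

lemma exists_forall_gap_le (h : State L → ℝ) {R : ℕ → State L → State L → Prop} {e₀ : ℕ}
    {η₀ ζ₀ : State L} (hR : R e₀ η₀ ζ₀) :
    ∃ e η ζ, R e η ζ ∧ ∀ e' η' ζ', R e' η' ζ' → gap h e η ζ ≤ gap h e' η' ζ' := by
  obtain ⟨C, hC⟩ := (Set.finite_range fun st : State L × State L => h st.1 - h st.2).bddBelow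
  have hfst : Tendsto (Prod.fst : ℕ × State L × State L → ℕ) cofinite atTop := by
    rw [← Nat.cofinite_eq_atTop]
    refine Tendsto.cofinite_of_finite_preimage_singleton fun e => ?_
    refine (Set.finite_range fun st : State L × State L => (e, st)).subset ?_
    rintro ⟨e', st⟩ rfl
    exact ⟨st, rfl⟩
  have hgap : Tendsto (fun t : ℕ × State L × State L => gap h t.1 t.2.1 t.2.2) cofinite atTop :=
    tendsto_atTop_mono (fun t => by
      have : C ≤ h t.2.1 - h t.2.2 := hC ⟨t.2, rfl⟩
      simp only [gap, Function.comp_apply]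
      linarith)
      (tendsto_atTop_add_const_right _ C
        ((tendsto_natCast_atTop_atTop.comp hfst).const_mul_atTop (two_pos (α := ℝ))))
  have hne : {t : ℕ × State L × State L | R t.1 t.2.1 t.2.2}.Nonempty := ⟨(e₀, η₀, ζ₀), hR⟩
  obtain ⟨⟨e, η, ζ⟩, hmem, hmin⟩ := hgap.exists_within_forall_le hne
  exact ⟨e, η, ζ, hmem, fun e' η' ζ' hR' => hmin (e', η', ζ') hR'⟩

lemma gap_eq (hh : h - stepMatrix u *ᵥ h = fun η => 2 * u η - 1) (e : ℕ) (η ζ : State L) :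
    gap h e η ζ = 2 * e + 2 * u η - 2 * u ζ + u η * h (push 1 η) + (1 - u η) * h (push (-1) η)
      - u ζ * h (push 1 ζ) - (1 - u ζ) * h (push (-1) ζ) := by
  have hη := congrFun hh η
  have hζ := congrFun hh ζ
  rw [Pi.sub_apply, stepMatrix_mulVec] at hη hζ
  unfold gap
  linarith

lemma gap_eq_monotone_coupling (hh : h - stepMatrix u *ᵥ h = fun η => 2 * u η - 1) (e : ℕ)
    (η ζ : State L) :
    gap h e η ζ = u ζ * gap h e (push 1 η) (push 1 ζ) +
      (1 - u η) * gap h e (push (-1) η) (push (-1) ζ) +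
      (u η - u ζ) * gap h (e + 1) (push 1 η) (push (-1) ζ) := by
  rw [gap_eq hh]
  unfold gap
  push_cast
  ring

lemma gap_eq_independent_coupling (hh : h - stepMatrix u *ᵥ h = fun η => 2 * u η - 1) (e : ℕ)
    (η ζ : State L) :
    gap h (e + 1) η ζ = u η * u ζ * gap h (e + 1) (push 1 η) (push 1 ζ) +
      (1 - u η) * (1 - u ζ) * gap h (e + 1) (push (-1) η) (push (-1) ζ) +
      u η * (1 - u ζ) * gap h (e + 2) (push 1 η) (push (-1) ζ) +
      (1 - u η) * u ζ * gap h e (push (-1) η) (push 1 ζ) := by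
  rw [gap_eq hh]
  unfold gap
  push_cast
  ring

namespace IsCoupling

variable {R : ℕ → State L → State L → Prop} {e : ℕ} {η ζ : State L}

/-- The gap at a minimum is an average of gaps, one of which belongs to a common step to the
right. -/
lemma gap_push_one_le (hR : IsCoupling u R) (hu : ∀ η, u η ∈ Set.Ioo 0 1)
    (hh : h - stepMatrix u *ᵥ h = fun η => 2 * u η - 1) (hRe : R e η ζ)
    (hmin : ∀ e' η' ζ', R e' η' ζ' → gap h e η ζ ≤ gap h e' η' ζ') :
    gap h e (push 1 η) (push 1 ζ) ≤ gap h e η ζ := by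
  obtain ⟨hη0, hη1⟩ := hu η
  obtain ⟨hζ0, hζ1⟩ := hu ζ
  have hdown := hmin _ _ _ (hR.down_down hRe)
  have happart := hmin _ _ _ (hR.up_down hRe)
  rcases le_or_gt (u ζ) (u η) with hle | hlt
  · have havg := gap_eq_monotone_coupling hh e η ζ
    refine le_of_mul_le_mul_left ?_ hζ0
    nlinarith [mul_le_mul_of_nonneg_left hdown (sub_nonneg.mpr hη1.le),
      mul_le_mul_of_nonneg_left happart (sub_nonneg.mpr hle)]
  · obtain ⟨e, rfl, hRe'⟩ := hR.down_up hRe hlt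
    have htogether := hmin _ _ _ hRe'
    have havg := gap_eq_independent_coupling hh e η ζ
    have hη1' := sub_pos.mpr hη1
    have hζ1' := sub_pos.mpr hζ1
    refine le_of_mul_le_mul_left ?_ (mul_pos hη0 hζ0)
    nlinarith [mul_le_mul_of_nonneg_left hdown (mul_pos hη1' hζ1').le,
      mul_le_mul_of_nonneg_left happart (mul_pos hη0 hζ1').le,
      mul_le_mul_of_nonneg_left htogether (mul_pos hη1' hζ0).le]

lemma two_mul_le_gap (hR : IsCoupling u R) (hu : ∀ η, u η ∈ Set.Ioo 0 1)
    (hh : h - stepMatrix u *ᵥ h = fun η => 2 * u η - 1) (hRe : R e η ζ)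
    (hmin : ∀ e' η' ζ', R e' η' ζ' → gap h e η ζ ≤ gap h e' η' ζ') :
    2 * (e : ℝ) ≤ gap h e η ζ := by
  have hiter : ∀ k, R e ((push 1)^[k] η) ((push 1)^[k] ζ) ∧
      gap h e ((push 1)^[k] η) ((push 1)^[k] ζ) ≤ gap h e η ζ := by
    intro k
    induction k with
    | zero => exact ⟨hRe, le_rfl⟩
    | succ k ih =>
      simp only [Function.iterate_succ_apply']
      exact ⟨hR.up_up ih.1, (hR.gap_push_one_le hu hh ih.1 fun e' η' ζ' hR' =>
        ih.2.trans (hmin e' η' ζ' hR')).trans ih.2⟩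
  have hmerged := (hiter L).2
  rwa [iterate_push_eq_const, iterate_push_eq_const, gap, add_sub_cancel_right] at hmerged

theorem gap_pos (hR : IsCoupling u R) (hu : ∀ η, u η ∈ Set.Ioo 0 1)
    (hh : h - stepMatrix u *ᵥ h = fun η => 2 * u η - 1) (he : 0 < e) (hRe : R e η ζ) :
    0 < gap h e η ζ := by
  obtain ⟨e₀, η₀, ζ₀, hR₀, hmin⟩ := exists_forall_gap_le h hRe
  have hnonneg : 0 ≤ gap h e₀ η₀ ζ₀ :=
    (by positivity : (0 : ℝ) ≤ 2 * e₀).trans (hR.two_mul_le_gap hu hh hR₀ hmin)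
  by_contra! hle
  have hbound := hR.two_mul_le_gap hu hh hRe fun e' η' ζ' hR' =>
    (hle.trans hnonneg).trans (hmin e' η' ζ' hR')
  have he' : (0 : ℝ) < e := by exact_mod_cast he
  linarith

end IsCoupling

/-- Two walks, in the states `η` and `ζ`, the first one being at present `2 * e` to the right of
the second one, and never having been to the left of it during the last `L` steps. -/
def Dominates (e : ℕ) (η ζ : State L) : Prop :=
  ∀ j ≤ L, partialSum η j ≤ 2 * e + partialSum ζ j

lemma Dominates.push {e e' : ℕ} {η ζ : State L} (hd : Dominates e η ζ) (ε δ : ℤˣ)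
    (he : 2 * (e' : ℤ) = 2 * e + ε - δ) : Dominates e' (push ε η) (push δ ζ)
  | 0, _ => by simp
  | j + 1, hj => by
    rw [partialSum_push _ _ hj, partialSum_push _ _ hj, he]
    linarith [hd j (by omega)]

lemma isCoupling_dominates
    (hu : ∀ η ζ : State L, (∀ j ≤ L, partialSum η j ≤ partialSum ζ j) → u ζ ≤ u η) :
    IsCoupling u Dominates where
  up_up hd := hd.push 1 1 (by ring)
  down_down hd := hd.push (-1) (-1) (by ring)
  up_down hd := hd.push 1 (-1) (by push_cast; ring)
  down_up {e η ζ} hd hlt := by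
    cases e with
    | zero => exact absurd (hu η ζ fun j hj => by simpa using hd j hj) hlt.not_ge
    | succ e => exact ⟨e, rfl, hd.push (-1) 1 (by push_cast; ring)⟩

lemma isCoupling_le_of_monotone (hu : Monotone u) : IsCoupling u fun _ η ζ => ζ ≤ η where
  up_up hle := push_mono le_rfl hle
  down_down hle := push_mono le_rfl hle
  up_down hle := push_mono (by decide) hle
  down_up hle hlt := absurd (hu hle) hlt.not_ge

lemma gap_push_one_push_neg_one_pos {p : ℝ} (hp : p ∈ Set.Ioo 0 1)
    (hh : h - stepMatrix (upProb p (1 - p)) *ᵥ h = fun η => 2 * upProb p (1 - p) η - 1)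
    (η : State L) : 0 < gap h 1 (push 1 η) (push (-1) η) := by
  have hu := upProb_mem_Ioo (L := L) hp ⟨sub_pos.mpr hp.2, sub_lt_self 1 hp.1⟩
  rcases le_total p (1 / 2) with hhalf | hhalf
  · exact (isCoupling_dominates fun _ _ => upProb_le_upProb_of_le_half hhalf).gap_pos hu hh
      one_pos (Dominates.push (e := 0) (fun j _ => by simp) 1 (-1) (by norm_num))
  · have hmono : Monotone (upProb p (1 - p) : State L → ℝ) := fun η ζ hle =>
      upProb_le_upProb hhalf fun j _ => partialSum_mono j hle
    exact (isCoupling_le_of_monotone hmono).gap_pos hu hh one_pos (push_mono (by decide) le_rfl)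

end Coupling

section Speed

variable {L : ℕ} {p q : ℝ} {π : State L → ℝ}

lemma IsPositiveStationary.speed_eq (hL : 1 ≤ L)
    (hπ : IsPositiveStationary (stepMatrix (upProb p q)) π) {h : State L → ℝ}
    (hh : h - stepMatrix (upProb p (1 - p)) *ᵥ h = fun η => 2 * upProb p (1 - p) η - 1) :
    speed p q π =
      (p + q - 1) * massMin fun η => π η * gap h 1 (push 1 η) (push (-1) η) := by
  classical
  have hstat : ∑ η, π η * ((stepMatrix (upProb p q) *ᵥ h) η - h η) = 0 := by
    simpa only [dotProduct, mul_sub, sum_sub_distrib, sub_eq_zero] using hπ.dotProduct_mulVec h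
  rw [← sum_mul_upProb_eq_speed hL, ← add_zero (∑ η, _), ← hstat, ← sum_add_distrib, massMin,
    mul_sum]
  refine sum_congr rfl fun η _ => ?_
  have hη := congrFun hh η
  have hdiff := upProb_sub_upProb hL p q (1 - p) η
  rw [Pi.sub_apply, stepMatrix_mulVec] at hη
  rw [stepMatrix_mulVec, gap, Nat.cast_one]
  calc π η * (2 * upProb p q η - 1) +
        π η * (upProb p q η * h (push 1 η) + (1 - upProb p q η) * h (push (-1) η) - h η)
      = π η * ((upProb p q η - upProb p (1 - p) η) * (2 + h (push 1 η) - h (push (-1) η))) := by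
        linear_combination (-π η) * hη
    _ = _ := by
        rw [hdiff]
        split_ifs <;> ring

lemma massMin_pos {f : State L → ℝ} (hf : ∀ η, 0 < f η) : 0 < massMin f := by
  classical
  refine sum_pos' (fun η _ => ?_) ⟨-1, mem_univ _, ?_⟩
  · split_ifs
    exacts [(hf η).le, le_rfl]
  · rw [if_pos isLocMin_neg_one]
    exact hf _

theorem IsPositiveStationary.exists_speed_eq_mul (hL : 1 ≤ L) (hp : p ∈ Set.Ioo 0 1)
    (hπ : IsPositiveStationary (stepMatrix (upProb p q)) π) :
    ∃ c > 0, speed p q π = (p + q - 1) * c := by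
  obtain ⟨h, hh⟩ := exists_sub_stepMatrix_mulVec_eq_drift
    (upProb_mem_Ioo (L := L) hp ⟨sub_pos.mpr hp.2, sub_lt_self 1 hp.1⟩) (upProb_neg hL p)
  exact ⟨_, massMin_pos fun η => mul_pos (hπ.pos η) (gap_push_one_push_neg_one_pos hp hh η),
    hπ.speed_eq hL hh⟩

end Speed

section Window

variable {L : ℕ} {x : ℕ → ℤ} {k : ℕ}

/-- The last `L` steps of the path `x` before time `k`, the most recent one first. Every step other
than `+1` is recorded as `-1`, so that `window` is defined for arbitrary paths. -/
def window (L : ℕ) (x : ℕ → ℤ) (k : ℕ) : State L := fun i =>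
  if x (k - i) - x (k - i - 1) = 1 then 1 else -1

lemma window_succ (L : ℕ) (x : ℕ → ℤ) (k : ℕ) :
    window L x (k + 1) = push (if x (k + 1) = x k + 1 then 1 else -1) (window L x k) := by
  funext i
  unfold push window
  by_cases h0 : (i : ℕ) = 0
  · simp only [h0, if_true, Nat.sub_zero, Nat.add_sub_cancel]
    exact if_congr (by omega) rfl rfl
  · simp only [h0, if_false]
    rw [show k + 1 - (i : ℕ) = k - (i - 1) by omega]

lemma comp_window_succ (φ : State L → ℝ) (x : ℕ → ℤ) (k : ℕ) :
    φ (window L x (k + 1)) = φ (push (-1) (window L x k)) +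
      (if x (k + 1) = x k + 1 then 1 else 0) *
        (φ (push 1 (window L x k)) - φ (push (-1) (window L x k))) := by
  rw [window_succ]
  split_ifs <;> ring

lemma dependsOn_window (L k : ℕ) : DependsOn (fun x => window L x k) (Set.Iic k) := by
  intro x y hxy
  funext i
  simp only [window, hxy _ (Nat.sub_le k i), hxy _ ((Nat.sub_le _ 1).trans (Nat.sub_le k i))]

lemma dependsOn_stepUp (L : ℕ) (p q : ℝ) (k : ℕ) :
    DependsOn (fun x => stepUp L p q x k) (Set.Iic k) := by
  intro x y hxy
  have hx : ∀ m, x (k - m) = y (k - m) := fun m => hxy _ (Nat.sub_le k m)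
  have hxk : x k = y k := hx 0
  have hmax : AtMax L x k ↔ AtMax L y k := by simp only [AtMax, hx, hxk]
  have hmin : AtMin L x k ↔ AtMin L y k := by simp only [AtMin, hx, hxk]
  simp only [stepUp]
  rw [hmax, hmin]

lemma abs_stepUp_le (L : ℕ) (p q : ℝ) (x : ℕ → ℤ) (k : ℕ) :
    |stepUp L p q x k| ≤ 1 / 2 + |p| + |q| := by
  have := abs_nonneg p
  have := abs_nonneg q
  have : |(1 / 2 : ℝ)| = 1 / 2 := abs_of_pos one_half_pos
  unfold stepUp
  split_ifs <;> linarith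

/-- The path `x` makes steps `+1` and `-1` only. -/
def NearestNeighbour (x : ℕ → ℤ) : Prop :=
  ∀ k, x (k + 1) = x k + 1 ∨ x (k + 1) = x k - 1

namespace NearestNeighbour

lemma window_apply (hx : NearestNeighbour x) (hk : L ≤ k) (i : Fin L) :
    (window L x k i : ℤ) = x (k - i) - x (k - i - 1) := by
  have hstep := hx (k - i - 1)
  rw [show k - (i : ℕ) - 1 + 1 = k - i by omega] at hstep
  unfold window
  split_ifs with hup
  · rw [hup, Units.val_one]
  · rw [Units.val_neg, Units.val_one]
    omega

lemma hasState_iff (hx : NearestNeighbour x) (hk : L ≤ k) (η : State L) :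
    HasState x k η ↔ window L x k = η := by
  unfold HasState
  rw [funext_iff]
  exact forall_congr' fun i => by rw [← hx.window_apply hk, Units.val_inj]

lemma partialSum_window (hx : NearestNeighbour x) (hk : L ≤ k) {j : ℕ} (hj : j ≤ L) :
    partialSum (window L x k) j = x k - x (k - j) := by
  induction j with
  | zero => simp
  | succ j ih =>
    rw [partialSum_succ _ hj, ih (by omega), hx.window_apply hk, Nat.sub_sub]
    ring

lemma atMax_iff (hx : NearestNeighbour x) (hk : L ≤ k) :
    AtMax L x k ↔ IsLocMax (window L x k) := by
  unfold AtMax IsLocMax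
  rw [min_eq_left hk]
  refine ⟨fun h j _ hj => ?_, fun h j hj => ?_⟩
  · rw [hx.partialSum_window hk hj]
    exact sub_nonneg.mpr (h j hj)
  · rcases j.eq_zero_or_pos with rfl | h0
    · rfl
    · exact sub_nonneg.mp (hx.partialSum_window hk hj ▸ h j h0 hj)

lemma atMin_iff (hx : NearestNeighbour x) (hk : L ≤ k) :
    AtMin L x k ↔ IsLocMin (window L x k) := by
  unfold AtMin IsLocMin
  rw [min_eq_left hk]
  refine ⟨fun h j _ hj => ?_, fun h j hj => ?_⟩
  · rw [hx.partialSum_window hk hj]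
    exact sub_nonpos.mpr (h j hj)
  · rcases j.eq_zero_or_pos with rfl | h0
    · rfl
    · exact sub_nonpos.mp (hx.partialSum_window hk hj ▸ h j h0 hj)

lemma stepUp_eq (hx : NearestNeighbour x) (hL : 1 ≤ L) (hk : L ≤ k) (p q : ℝ) :
    stepUp L p q x k = upProb p q (window L x k) := by
  unfold stepUp upProb
  rw [hx.atMax_iff hk, hx.atMin_iff hk, if_neg fun h => h.1.not_isLocMin hL h.2]

lemma occupation_eq (hx : NearestNeighbour x) (η : State L) :
    occupation x η = fun n : ℕ =>
      (∑ k ∈ range n, (Pi.single η 1 : State L → ℝ) (window L x (L + k))) / n := by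
  classical
  funext n
  unfold occupation
  rw [card_filter]
  push_cast
  congr 1
  refine sum_congr rfl fun k _ => ?_
  rw [Pi.single_apply]
  exact if_congr (hx.hasState_iff (Nat.le_add_right L k) η) rfl rfl

end NearestNeighbour

end Window

section History

variable {Ω : Type*} {mΩ : MeasurableSpace Ω} {μ : Measure Ω}

lemma ae_eq_condExp_comap_of_forall_setIntegral_fiber_eq [IsFiniteMeasure μ] {E : Type*}
    [Countable E] [MeasurableSpace E] [MeasurableSingletonClass E] {W : Ω → E} (hW : Measurable W)
    {f g : Ω → ℝ} (hf : Integrable f μ) (hg : Integrable g μ)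
    (hgW : StronglyMeasurable[.comap W inferInstance] g)
    (hfg : ∀ ω, ∫ ω' in W ⁻¹' {W ω}, g ω' ∂μ = ∫ ω' in W ⁻¹' {W ω}, f ω' ∂μ) :
    g =ᵐ[μ] μ[f | .comap W inferInstance] := by
  have hfiber : ∀ e, ∫ ω in W ⁻¹' {e}, g ω ∂μ = ∫ ω in W ⁻¹' {e}, f ω ∂μ := fun e => by
    rcases (W ⁻¹' {e}).eq_empty_or_nonempty with hempty | ⟨ω, rfl⟩
    · rw [hempty, setIntegral_empty, setIntegral_empty]
    · exact hfg ω
  refine ae_eq_condExp_of_forall_setIntegral_eq hW.comap_le hf (fun _ _ _ => hg.integrableOn) ?_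
    hgW.aestronglyMeasurable
  rintro _ ⟨t, -, rfl⟩ -
  have hmeas : ∀ e : t, MeasurableSet (W ⁻¹' {(e : E)}) := fun e => hW (measurableSet_singleton _)
  have hdisj : Pairwise (Function.onFun Disjoint fun e : t => W ⁻¹' {(e : E)}) := fun e e' hne =>
    Disjoint.preimage _ (Set.disjoint_singleton.mpr fun h => hne (Subtype.ext h))
  rw [← Set.biUnion_preimage_singleton, Set.biUnion_eq_iUnion,
    integral_iUnion hmeas hdisj hg.integrableOn, integral_iUnion hmeas hdisj hf.integrableOn]
  exact tsum_congr fun e => hfiber e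

/-- The filtration `ℱ` with the time shifted, so that it starts with `ℱ m`. -/
def shiftFiltration (ℱ : Filtration ℕ mΩ) (m : ℕ) : Filtration ℕ mΩ where
  seq n := ℱ (m + n)
  mono' _ _ h := ℱ.mono (Nat.add_le_add_left h m)
  le' n := ℱ.le (m + n)

variable {X : ℕ → Ω → ℤ}

/-- The natural filtration of the integer-valued process `X`. -/
abbrev history (hX : ∀ k, Measurable (X k)) : Filtration ℕ mΩ :=
  Filtration.natural X fun k => (hX k).stronglyMeasurable

lemma measurable_history_of_dependsOn (hX : ∀ k, Measurable (X k)) {β : Type*} [Nonempty β]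
    {mβ : MeasurableSpace β} {f : (ℕ → ℤ) → β} {k : ℕ} (hf : DependsOn f (Set.Iic k)) :
    Measurable[history hX k] fun ω => f fun j => X j ω := by
  obtain ⟨g, rfl⟩ := dependsOn_iff_exists_comp.mp hf
  rw [history, Filtration.natural_eq_comap]
  exact Measurable.of_discrete.comp (comap_measurable _)

lemma condExp_indicator_increment [IsFiniteMeasure μ] (hX : ∀ k, Measurable (X k)) {k : ℕ} {d : ℤ}
    {s : (ℕ → ℤ) → ℝ} (hs : DependsOn s (Set.Iic k))
    (hint : Integrable (fun ω => s fun j => X j ω) μ)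
    (hstep : ∀ x : ℕ → ℤ, μ.real {ω | (∀ j ≤ k, X j ω = x j) ∧ X (k + 1) ω = x k + d} =
      s x * μ.real {ω | ∀ j ≤ k, X j ω = x j}) :
    μ[{ω | X (k + 1) ω = X k ω + d}.indicator fun _ => (1 : ℝ) | history hX k] =ᵐ[μ]
      fun ω => s fun j => X j ω := by
  have hsX := (measurable_history_of_dependsOn hX hs).stronglyMeasurable
  have hU : MeasurableSet {ω | X (k + 1) ω = X k ω + d} :=
    measurableSet_eq_fun (hX _) ((hX k).add_const d)
  set W : Ω → Set.Iic k → ℤ := fun ω j => X j ω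
  have hW : Measurable W := measurable_pi_lambda _ fun j => hX j
  rw [history, Filtration.natural_eq_comap] at hsX ⊢
  refine (ae_eq_condExp_comap_of_forall_setIntegral_fiber_eq hW
    ((integrable_const 1).indicator hU) hint hsX fun ω₀ => ?_).symm
  have hfiber : W ⁻¹' {W ω₀} = {ω | ∀ j ≤ k, X j ω = X j ω₀} := by
    ext ω
    simp [W, funext_iff]
  have hconst : ∀ ω ∈ W ⁻¹' {W ω₀}, s (fun j => X j ω) = s fun j => X j ω₀ := by
    rw [hfiber]
    exact fun ω hω => hs hω
  have hinter : W ⁻¹' {W ω₀} ∩ {ω | X (k + 1) ω = X k ω + d} =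
      {ω | (∀ j ≤ k, X j ω = X j ω₀) ∧ X (k + 1) ω = X k ω₀ + d} := by
    rw [hfiber]
    ext ω
    exact and_congr_right fun h => by rw [Set.mem_ofPred_eq, h k le_rfl]
  rw [setIntegral_congr_fun (hW (measurableSet_singleton _)) hconst, setIntegral_const,
    setIntegral_indicator hU, setIntegral_const, hinter, hstep fun j => X j ω₀, hfiber, smul_eq_mul,
    smul_eq_mul, mul_one, mul_comm]

end History

namespace IsPerturbedWalk

variable {Ω : Type*} {mΩ : MeasurableSpace Ω} {μ : Measure Ω} {L : ℕ} {p q : ℝ}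
  {X : ℕ → Ω → ℤ}

lemma stronglyMeasurable_comp_window (h : IsPerturbedWalk μ L p q X) (φ : State L → ℝ) (k : ℕ) :
    StronglyMeasurable[history h.measurable k] fun ω => φ (window L (fun j => X j ω) k) :=
  (measurable_history_of_dependsOn h.measurable fun _ _ hxy =>
    congrArg φ (dependsOn_window L k hxy)).stronglyMeasurable

variable [IsFiniteMeasure μ]

lemma integrable_stepUp (h : IsPerturbedWalk μ L p q X) (k : ℕ) :
    Integrable (fun ω => stepUp L p q (fun j => X j ω) k) μ :=
  .of_bound ((measurable_history_of_dependsOn h.measurable (dependsOn_stepUp L p q k)).mono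
    ((history h.measurable).le k) le_rfl).aestronglyMeasurable _
    (.of_forall fun ω => abs_stepUp_le L p q (fun j => X j ω) k)

lemma condExp_indicator_right (h : IsPerturbedWalk μ L p q X) (k : ℕ) :
    μ[{ω | X (k + 1) ω = X k ω + 1}.indicator fun _ => (1 : ℝ) | history h.measurable k] =ᵐ[μ]
      fun ω => stepUp L p q (fun j => X j ω) k :=
  condExp_indicator_increment h.measurable (dependsOn_stepUp L p q k) (h.integrable_stepUp k)
    (h.step_right k)

lemma condExp_indicator_left (h : IsPerturbedWalk μ L p q X) (k : ℕ) :
    μ[{ω | X (k + 1) ω = X k ω - 1}.indicator fun _ => (1 : ℝ) | history h.measurable k] =ᵐ[μ]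
      fun ω => 1 - stepUp L p q (fun j => X j ω) k :=
  condExp_indicator_increment (d := -1) h.measurable
    (s := fun x => 1 - stepUp L p q x k)
    (fun _ _ hxy => congrArg (1 - ·) (dependsOn_stepUp L p q k hxy))
    ((integrable_const 1).sub (h.integrable_stepUp k)) (h.step_left k)

lemma ae_nearestNeighbour (h : IsPerturbedWalk μ L p q X) :
    ∀ᵐ ω ∂μ, NearestNeighbour fun k => X k ω := by
  refine ae_all_iff.mpr fun k => ?_
  set R := {ω | X (k + 1) ω = X k ω + 1} with hR
  set S := {ω | X (k + 1) ω = X k ω - 1} with hS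
  have hRm : MeasurableSet R := measurableSet_eq_fun (h.measurable _) ((h.measurable k).add_const 1)
  have hSm : MeasurableSet S := measurableSet_eq_fun (h.measurable _) ((h.measurable k).sub_const 1)
  have hle := (history h.measurable).le k
  have hRμ : μ.real R = ∫ ω, stepUp L p q (fun j => X j ω) k ∂μ := by
    rw [← integral_congr_ae (h.condExp_indicator_right k), integral_condExp hle,
      integral_indicator_const _ hRm, smul_eq_mul, mul_one]
  have hSμ : μ.real S = ∫ ω, (1 - stepUp L p q (fun j => X j ω) k) ∂μ := by
    rw [← integral_congr_ae (h.condExp_indicator_left k), integral_condExp hle,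
      integral_indicator_const _ hSm, smul_eq_mul, mul_one]
  have hdisj : Disjoint R S := Set.disjoint_left.mpr fun ω hωR hωS => by
    rw [hR, Set.mem_ofPred_eq] at hωR
    rw [hS, Set.mem_ofPred_eq] at hωS
    omega
  have hunion : μ.real (R ∪ S) = μ.real Set.univ := by
    rw [measureReal_union hdisj hSm, hRμ, hSμ,
      integral_sub (integrable_const 1) (h.integrable_stepUp k), integral_const, smul_eq_mul]
    ring
  have hcompl : μ (R ∪ S)ᶜ = 0 := by
    rw [← measureReal_eq_zero_iff, measureReal_compl (hRm.union hSm), hunion, sub_self]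
  exact hcompl

lemma integrable_comp_window (h : IsPerturbedWalk μ L p q X) (φ : State L → ℝ) (k : ℕ) :
    Integrable (fun ω => φ (window L (fun j => X j ω) k)) μ := by
  obtain ⟨c, hc⟩ := (Set.finite_range fun η => ‖φ η‖).bddAbove
  exact .of_bound ((h.stronglyMeasurable_comp_window φ k).mono
    ((history h.measurable).le k)).aestronglyMeasurable c (.of_forall fun ω => hc ⟨_, rfl⟩)

lemma condExp_comp_window_succ (h : IsPerturbedWalk μ L p q X) (hL : 1 ≤ L) {k : ℕ} (hk : L ≤ k)
    (φ : State L → ℝ) :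
    μ[fun ω => φ (window L (fun j => X j ω) (k + 1)) | history h.measurable k] =ᵐ[μ]
      fun ω => (stepMatrix (upProb p q) *ᵥ φ) (window L (fun j => X j ω) k) := by
  set U : Ω → ℝ := {ω | X (k + 1) ω = X k ω + 1}.indicator fun _ => 1
  set A : State L → ℝ := fun η => φ (push (-1) η)
  set B : State L → ℝ := fun η => φ (push 1 η) - φ (push (-1) η)
  have hA := h.stronglyMeasurable_comp_window A k
  have hB := h.stronglyMeasurable_comp_window B k
  have hAint := h.integrable_comp_window A k
  have hBint := h.integrable_comp_window B k
  have hUint : Integrable U μ := (integrable_const 1).indicator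
    (measurableSet_eq_fun (h.measurable _) ((h.measurable k).add_const 1))
  have hUB : Integrable (U * fun ω => B (window L (fun j => X j ω) k)) μ :=
    hBint.bdd_mul (c := 1) hUint.aestronglyMeasurable
      (.of_forall fun ω => (norm_indicator_le_norm_self _ ω).trans_eq norm_one)
  have hsplit : (fun ω => φ (window L (fun j => X j ω) (k + 1))) =
      (fun ω => A (window L (fun j => X j ω) k)) +
        U * fun ω => B (window L (fun j => X j ω) k) := by
    funext ω
    rw [comp_window_succ φ]
    simp only [U, A, B, Pi.add_apply, Pi.mul_apply, Set.indicator_apply, Set.mem_ofPred_eq]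
  rw [hsplit]
  filter_upwards [condExp_add hAint hUB (history h.measurable k),
    condExp_mul_of_stronglyMeasurable_right hB hUB hUint, h.condExp_indicator_right k,
    h.ae_nearestNeighbour] with ω hadd hmul hright hnn
  rw [hadd, Pi.add_apply, hmul, Pi.mul_apply, hright, hnn.stepUp_eq hL hk,
    condExp_of_stronglyMeasurable ((history h.measurable).le k) hA hAint, stepMatrix_mulVec]
  ring

lemma isMarkovChain_window (h : IsPerturbedWalk μ L p q X) (hL : 1 ≤ L) :
    IsMarkovChain μ (shiftFiltration (history h.measurable) L) (stepMatrix (upProb p q))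
      fun n ω => window L (fun j => X j ω) (L + n) where
  measurable n := measurable_history_of_dependsOn h.measurable (dependsOn_window L (L + n))
  condExp_eq n φ := h.condExp_comp_window_succ hL (Nat.le_add_right L n) φ

theorem isLimitingOccupation (h : IsPerturbedWalk μ L p q X) (hL : 1 ≤ L) (hp : p ∈ Set.Ioo 0 1)
    (hq : q ∈ Set.Ioo 0 1) {π : State L → ℝ}
    (hπ : IsPositiveStationary (stepMatrix (upProb p q)) π) : IsLimitingOccupation μ X π := by
  have hu := upProb_mem_Ioo (L := L) hp hq
  have haverage := fun η : State L => (h.isMarkovChain_window hL).ae_tendsto_average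
    (stepMatrix_mem_rowStochastic hu) (stepMatrix_isIrreducible hu) hπ (Pi.single η 1)
  filter_upwards [h.ae_nearestNeighbour, ae_all_iff.mpr haverage] with ω hnn hω η
  simpa only [hnn.occupation_eq, dotProduct_single_one] using hω η

end IsPerturbedWalk

end PerturbedWalk

theorem lemma2 (L : ℕ) (hL : 1 ≤ L) (p q : ℝ) (hp0 : 0 < p) (hp1 : p < 1)
    (hq0 : 0 < q) (hq1 : q < 1) :
    ∃ π : PerturbedWalk.State L → ℝ,
      (∀ (Ω : Type*) [MeasurableSpace Ω] (μ : MeasureTheory.Measure Ω)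
        [MeasureTheory.IsProbabilityMeasure μ] (X : ℕ → Ω → ℤ),
        PerturbedWalk.IsPerturbedWalk μ L p q X → PerturbedWalk.IsLimitingOccupation μ X π) ∧
      (PerturbedWalk.speed p q π < 0 ↔ p + q - 1 < 0) ∧
      (PerturbedWalk.speed p q π = 0 ↔ p + q - 1 = 0) ∧
      (0 < PerturbedWalk.speed p q π ↔ 0 < p + q - 1) := by
  have hp : p ∈ Set.Ioo 0 1 := ⟨hp0, hp1⟩
  have hq : q ∈ Set.Ioo 0 1 := ⟨hq0, hq1⟩
  have hu := PerturbedWalk.upProb_mem_Ioo (L := L) hp hq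
  obtain ⟨π, hπ⟩ := PerturbedWalk.exists_isPositiveStationary
    (PerturbedWalk.stepMatrix_mem_rowStochastic hu) (PerturbedWalk.stepMatrix_isIrreducible hu)
  obtain ⟨c, hc, hspeed⟩ := hπ.exists_speed_eq_mul hL hp
  refine ⟨π, fun Ω _ μ _ X hX => hX.isLimitingOccupation hL hp hq hπ, ?_⟩
  rw [hspeed]
  exact ⟨⟨fun h => neg_of_mul_neg_left h hc.le, fun h => mul_neg_of_neg_of_pos h hc⟩,
    mul_eq_zero_iff_right hc.ne', mul_pos_iff_of_pos_right hc⟩
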